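/- Call a subspace $U\subseteq\mathbb{R}^n$ realizable if there is an $n\times n$ correlation matrix $Q$ (a real symmetric positive semidefinite matrix with unit diagonal) whose nullspace contains $U$. By a random $r$-dimensional subspace of $\mathbb{R}^n$, $0\le r\le n$, we mean the column space of an $n\times r$ matrix with i.i.d. standard Gaussian entries (which has dimension $r$ almost surely). Let $0<\epsilon<1/2$. There are positive constants $\bar c,\tilde c$, depending only on $\epsilon$, such that for every integer $n>6/(\epsilon^2-2\epsilon^3)$ and every integer $0\le r\le(1/2-\epsilon)n$ (in particular for $r=(1/2-\epsilon)n$ whenever this is an integer), if $U$ is a random $r$-dimensional subspace of $\mathbb{R}^n$, then $$\Pr[\,U\text{ is realizable}\,]\ \ge\ 1-\bar c\,\sqrt n\,e^{-\tilde c n}.$$ -/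

import Mathlib

open MeasureTheory ProbabilityTheory

/-- A correlation matrix: a (symmetric) positive semidefinite real matrix with unit diagonal. -/
def IsCorrelationMatrix {n : ℕ} (Q : Matrix (Fin n) (Fin n) ℝ) : Prop :=
  Q.PosSemidef ∧ ∀ i, Q i i = 1

/-- A subspace of `ℝⁿ` is realizable if it is contained in the nullspace of some
`n × n` correlation matrix. -/
def IsRealizable {n : ℕ} (U : Submodule ℝ (Fin n → ℝ)) : Prop :=
  ∃ Q : Matrix (Fin n) (Fin n) ℝ, IsCorrelationMatrix Q ∧ U ≤ LinearMap.ker Q.mulVecLin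

/-- The column space of a real `n × r` matrix. -/
def columnSpace {n r : ℕ} (A : Matrix (Fin n) (Fin r) ℝ) : Submodule ℝ (Fin n → ℝ) :=
  LinearMap.range A.mulVecLin

/-- A random `n × r` matrix whose entries are independent standard Gaussians. Its column space,
which has dimension `r` almost surely when `r ≤ n`, is the random `r`-dimensional subspace
of `ℝⁿ`. -/
def IsStdGaussianMatrix {Ω : Type*} [MeasurableSpace Ω] (P : Measure Ω) {n r : ℕ}
    (G : Ω → Matrix (Fin n) (Fin r) ℝ) : Prop :=
  (∀ i j, HasLaw (fun ω => G ω i j) (gaussianReal 0 1) P) ∧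
    iIndepFun (fun (p : Fin n × Fin r) (ω : Ω) => G ω p.1 p.2) P

/-! Let `S` be the orthogonal projection onto the complement of `U`. If every `S i i` exceeds 1/2,
the matrix of squares of the entries of `S` is strictly diagonally dominant and sends some `w ≥ 0`
to the all-ones vector; then `S * diagonal w * S` is a correlation matrix killing `U`
(`isRealizable_of_lt_norm_starProjection`). It remains to bound, for each `i`, the probability that
`S i i ≤ 1/2`. By rotation invariance the basis vector may be replaced by an independent Gaussian
vector, and by Fubini the subspace may then be frozen (`pi_stdGaussian_nearSpan_le`). A Chernoff
bound for two independent chi-square sums finishes, followed by a union bound over `i`. -/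

/-! ### Linear algebra: correlation matrices from projections. -/

section Deterministic

open Matrix

/-- A nonnegative matrix with row sums `p i > 1 / 2` and diagonal entries `p i ^ 2` is strictly
diagonally dominant, and the solution of `M *ᵥ w = 1` is nonnegative. -/
lemma exists_nonneg_mulVec_eq_one {ι : Type*} [Fintype ι] [DecidableEq ι]
    (M : Matrix ι ι ℝ) (p : ι → ℝ) (hM : ∀ i j, 0 ≤ M i j) (hdiag : ∀ i, M i i = p i ^ 2)
    (hrow : ∀ i, ∑ j, M i j = p i) (hp : ∀ i, 1 / 2 < p i) :
    ∃ w : ι → ℝ, (∀ i, 0 ≤ w i) ∧ M *ᵥ w = 1 := by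
  have hoff : ∀ i, ∑ j ∈ Finset.univ.erase i, M i j = p i - p i ^ 2 := fun i => by
    rw [← hdiag, ← hrow i, ← Finset.add_sum_erase _ (fun j => M i j) (Finset.mem_univ i)]
    ring
  have hp1 : ∀ i, p i ≤ 1 := fun i => by
    have h := Finset.sum_nonneg fun j (_ : j ∈ Finset.univ.erase i) => hM i j
    rw [hoff] at h
    nlinarith [hp i]
  have hdet : M.det ≠ 0 := det_ne_zero_of_sum_row_lt_diag fun k => by
    simp_rw [Real.norm_of_nonneg (hM _ _)]
    rw [hoff, hdiag]
    nlinarith [hp k]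
  refine ⟨M⁻¹ *ᵥ 1, ?_, by rw [mulVec_mulVec, mul_nonsing_inv _ hdet.isUnit, one_mulVec]⟩
  have hw : M *ᵥ (M⁻¹ *ᵥ 1) = 1 := by rw [mulVec_mulVec, mul_nonsing_inv _ hdet.isUnit, one_mulVec]
  generalize M⁻¹ *ᵥ 1 = w at hw
  have hw' : ∀ i, p i ^ 2 * w i + ∑ j ∈ Finset.univ.erase i, M i j * w j = 1 := fun i => by
    rw [← hdiag, Finset.add_sum_erase _ (fun j => M i j * w j) (Finset.mem_univ i)]
    exact congrFun hw i
  intro i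
  have : Nonempty ι := ⟨i⟩
  obtain ⟨m, hm⟩ := Finite.exists_min w
  obtain ⟨k, hk⟩ := Finite.exists_max w
  refine le_trans ?_ (hm i)
  -- Rows `m` (minimum) and `k` (maximum) give two inequalities in `w m` and `w k` alone.
  -- Eliminating `w k` leaves `w m * (p k * p m * (p k + p m - 1)) ≥ p k ^ 2 - (p m - p m ^ 2)`,
  -- whose right side is positive because `p k ^ 2 > 1/4 ≥ p m - p m ^ 2`.
  have h1 : 1 ≤ p m ^ 2 * w m + (p m - p m ^ 2) * w k := by
    rw [← hw' m, ← hoff, Finset.sum_mul]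
    gcongr with j
    · exact hM m j
    · exact hk j
  have h2 : p k ^ 2 * w k + (p k - p k ^ 2) * w m ≤ 1 := by
    rw [← hw' k, ← hoff, Finset.sum_mul]
    gcongr with j
    · exact hM k j
    · exact hm j
  have hpm := hp m
  have hpk := hp k
  have h3 := mul_le_mul_of_nonneg_left h1 (sq_nonneg (p k))
  have h4 := mul_le_mul_of_nonneg_left h2 (show 0 ≤ p m - p m ^ 2 by nlinarith [hp1 m])
  have h5 : 0 < w m * (p k * p m * (p k + p m - 1)) := by nlinarith [sq_nonneg (p m - 1 / 2)]
  have h6 : 0 < p k * p m * (p k + p m - 1) := by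
    have := mul_pos (show 0 < p k by linarith) (show 0 < p m by linarith)
    exact mul_pos this (by linarith)
  exact (pos_of_mul_pos_left h5 h6.le).le

/-- A symmetric idempotent matrix `S` with diagonal entries exceeding `1 / 2` admits a correlation
matrix whose kernel contains the kernel of `S`. -/
lemma exists_isCorrelationMatrix_of_isStarProjection {n : ℕ} {S : Matrix (Fin n) (Fin n) ℝ}
    (hS : IsStarProjection S) (hd : ∀ i, 1 / 2 < S i i) :
    ∃ Q, IsCorrelationMatrix Q ∧ ∀ x, S *ᵥ x = 0 → Q *ᵥ x = 0 := by
  have hsymm : ∀ i j, S j i = S i j := fun i j => by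
    simpa [star_apply] using congrFun (congrFun hS.isSelfAdjoint.star_eq i) j
  have hrow : ∀ i, ∑ j, S i j ^ 2 = S i i := fun i => by
    have h := congrFun (congrFun hS.isIdempotentElem.eq i) i
    rw [mul_apply] at h
    rw [← h]
    exact Finset.sum_congr rfl fun j _ => by rw [hsymm i j, sq]
  -- The `i`-th diagonal entry of `S * diagonal w * S` is `∑ j, S i j ^ 2 * w j`, so a unit diagonal
  -- is exactly this linear system.
  obtain ⟨w, hw0, hw⟩ := exists_nonneg_mulVec_eq_one (of fun i j => S i j ^ 2) (fun i => S i i)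
    (fun i j => sq_nonneg _) (fun i => rfl) (by simpa using hrow) hd
  refine ⟨S * diagonal w * S, ⟨?_, fun i => ?_⟩, fun x hx => ?_⟩
  · have h := (PosSemidef.diagonal hw0).mul_mul_conjTranspose_same S
    rwa [← star_eq_conjTranspose, hS.isSelfAdjoint.star_eq] at h
  · have h := congrFun hw i
    simp only [mulVec, dotProduct, of_apply, Pi.one_apply] at h
    rw [← h, mul_apply]
    refine Finset.sum_congr rfl fun j _ => ?_
    rw [mul_diagonal, hsymm i j]
    ring
  · rw [← mulVec_mulVec, hx, mulVec_zero]

/-- A subspace is realizable as soon as every standard basis vector is nearer to its orthogonal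
complement than to the subspace itself. -/
lemma isRealizable_of_lt_norm_starProjection {n : ℕ} (U : Submodule ℝ (Fin n → ℝ))
    (K : Submodule ℝ (EuclideanSpace ℝ (Fin n))) (hUK : ∀ x ∈ U, WithLp.toLp 2 x ∈ K)
    (h : ∀ i, 1 < 2 * ‖Kᗮ.starProjection (EuclideanSpace.single i (1 : ℝ))‖ ^ 2) :
    IsRealizable U := by
  let S : Matrix (Fin n) (Fin n) ℝ := (toEuclideanCLM (𝕜 := ℝ)).symm Kᗮ.starProjection
  have hSK : toEuclideanCLM (𝕜 := ℝ) S = Kᗮ.starProjection := StarAlgEquiv.apply_symm_apply _ _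
  have hP : IsStarProjection Kᗮ.starProjection := isStarProjection_starProjection
  have hS : IsStarProjection S :=
    ⟨EquivLike.injective (toEuclideanCLM (n := Fin n) (𝕜 := ℝ))
      (by rw [map_mul, hSK, hP.isIdempotentElem.eq]),
    EquivLike.injective (toEuclideanCLM (n := Fin n) (𝕜 := ℝ))
      (by rw [map_star, hSK, hP.isSelfAdjoint.star_eq])⟩
  obtain ⟨Q, hQ, hker⟩ := exists_isCorrelationMatrix_of_isStarProjection hS fun i => by
    have h1 := inner_toEuclideanCLM S (EuclideanSpace.single i 1) (EuclideanSpace.single i 1)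
    rw [hSK, ← Submodule.inner_starProjection_left_eq_right] at h1
    have h2 := Submodule.starProjection_eq_self_iff.2
      (Submodule.starProjection_apply_mem Kᗮ (EuclideanSpace.single i (1 : ℝ)))
    rw [← h2, Submodule.inner_starProjection_left_eq_right, real_inner_self_eq_norm_sq] at h1
    have h3 : (EuclideanSpace.single i (1 : ℝ)).ofLp ⬝ᵥ
        S *ᵥ (EuclideanSpace.single i (1 : ℝ)).ofLp = S i i := by simp
    linarith [h i]
  refine ⟨Q, hQ, fun x hx => ?_⟩
  rw [LinearMap.mem_ker, mulVecLin_apply]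
  refine hker x ?_
  rw [← ofLp_toEuclideanCLM S (WithLp.toLp 2 x), hSK,
    Submodule.starProjection_orthogonal_apply_eq_zero (hUK x hx), WithLp.ofLp_zero]

end Deterministic

/-! ### Gaussian concentration for a fixed subspace. -/

section Chernoff

open Real

/-- The exponential moments of the square of a standard Gaussian variable. -/
lemma integral_exp_mul_sq_gaussianReal {s : ℝ} (hs : s < 1) :
    ∫ x, exp (s / 2 * x ^ 2) ∂(gaussianReal 0 1) = (√(1 - s))⁻¹ := by
  rw [integral_gaussianReal_eq_integral_smul one_ne_zero]
  have h : ∀ x : ℝ, gaussianPDFReal 0 1 x • exp (s / 2 * x ^ 2) =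
      (√(2 * π))⁻¹ * exp (-((1 - s) / 2) * x ^ 2) := fun x => by
    simp only [gaussianPDFReal, smul_eq_mul, mul_assoc, ← exp_add, NNReal.coe_one]
    ring_nf
  simp_rw [h]
  rw [integral_const_mul, integral_gaussian, ← sqrt_inv, ← sqrt_inv, ← sqrt_mul (by positivity)]
  congr 1
  have : 1 - s ≠ 0 := by linarith
  field_simp

variable {E : Type*} [NormedAddCommGroup E] [InnerProductSpace ℝ E] [FiniteDimensional ℝ E]
  [MeasurableSpace E] [BorelSpace E]

/-- The norm of a vector expressed in an orthonormal basis. -/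
lemma norm_sq_sum_smul_orthonormalBasis {ι F : Type*} [Fintype ι] [NormedAddCommGroup F]
    [InnerProductSpace ℝ F] (b : OrthonormalBasis ι ℝ F) (x : ι → ℝ) :
    ‖∑ i, x i • b i‖ ^ 2 = ∑ i, x i ^ 2 := by
  have h := b.sum_repr_symm (WithLp.toLp 2 x)
  simp only at h
  rw [h, LinearIsometryEquiv.norm_map, EuclideanSpace.norm_sq_eq]
  simp

/-- The exponential moments of the difference between the squared norms of the components of a
standard Gaussian vector in a subspace and in its orthogonal complement. -/
lemma integral_exp_norm_starProjection_stdGaussian (U : Submodule ℝ E) {s : ℝ} (hs : |s| < 1) :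
    ∫ z, exp (s / 2 * (‖U.starProjection z‖ ^ 2 - ‖Uᗮ.starProjection z‖ ^ 2)) ∂(stdGaussian E) =
      (√(1 - s))⁻¹ ^ Module.finrank ℝ U * (√(1 + s))⁻¹ ^ Module.finrank ℝ Uᗮ := by
  obtain ⟨hs1, hs2⟩ := abs_lt.1 hs
  let u := stdOrthonormalBasis ℝ U
  let v := stdOrthonormalBasis ℝ Uᗮ
  -- In a basis adapted to `U` and its complement the exponential factors over independent
  -- coordinates, with parameter `s` on `U` and `-s` on the complement.
  let b := (u.prod v).map U.orthogonalDecomposition.symm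
  have hb : ∀ x : Fin (Module.finrank ℝ U) ⊕ Fin (Module.finrank ℝ Uᗮ) → ℝ,
      ∑ i, x i • b i = ((∑ i, x (.inl i) • u i : U) : E) + ((∑ i, x (.inr i) • v i : Uᗮ) : E) := by
    intro x
    simp [b, Fintype.sum_sum_type]
  have hU : ∀ (p : U) (q : Uᗮ), U.starProjection ((p : E) + q) = p := fun p q => by
    rw [map_add, Submodule.starProjection_eq_self_iff.2 p.2,
      (U.starProjection_apply_eq_zero_iff).2 q.2, add_zero]
  have hV : ∀ (p : U) (q : Uᗮ), Uᗮ.starProjection ((p : E) + q) = q := fun p q => by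
    rw [map_add, Submodule.starProjection_eq_self_iff.2 q.2,
      Submodule.starProjection_orthogonal_apply_eq_zero p.2, zero_add]
  rw [stdGaussian_eq_map_pi_orthonormalBasis b, integral_map (Measurable.aemeasurable (by fun_prop))
    (Measurable.aestronglyMeasurable (by fun_prop))]
  have key : ∀ x : Fin (Module.finrank ℝ U) ⊕ Fin (Module.finrank ℝ Uᗮ) → ℝ,
      exp (s / 2 * (‖U.starProjection (∑ i, x i • b i)‖ ^ 2 -
        ‖Uᗮ.starProjection (∑ i, x i • b i)‖ ^ 2)) =
      ∏ i, exp (Sum.elim (fun _ => s) (fun _ => -s) i / 2 * x i ^ 2) := by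
    intro x
    rw [hb, hU, hV, ← Submodule.coe_norm, ← Submodule.coe_norm, norm_sq_sum_smul_orthonormalBasis,
      norm_sq_sum_smul_orthonormalBasis, ← exp_sum, Fintype.sum_sum_type]
    simp only [Sum.elim_inl, Sum.elim_inr, ← Finset.mul_sum]
    ring_nf
  simp_rw [key]
  rw [integral_fintype_prod_eq_prod
    (f := fun i y => exp (Sum.elim (fun _ => s) (fun _ => -s) i / 2 * y ^ 2)),
    Fintype.prod_sum_type]
  simp only [Sum.elim_inl, Sum.elim_inr, Finset.prod_const, Finset.card_univ, Fintype.card_fin]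
  rw [integral_exp_mul_sq_gaussianReal hs2, integral_exp_mul_sq_gaussianReal (by linarith),
    sub_neg_eq_add]

/-- Chernoff bound: a standard Gaussian vector is unlikely to be nearer to a subspace of small
dimension than to its orthogonal complement. -/
lemma stdGaussian_norm_starProjection_orthogonal_le (U : Submodule ℝ E) {ε : ℝ} (hε₀ : 0 < ε)
    (hε₁ : ε < 1 / 2)
    (hU : (Module.finrank ℝ U : ℝ) ≤ (1 / 2 - ε) * Module.finrank ℝ E) :
    (stdGaussian E).real {z | 2 * ‖Uᗮ.starProjection z‖ ^ 2 ≤ ‖z‖ ^ 2} ≤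
      exp (-(ε ^ 2 / 2) * Module.finrank ℝ E) := by
  have hI := integral_exp_norm_starProjection_stdGaussian U (s := ε)
    (abs_lt.2 ⟨by linarith, by linarith⟩)
  have h1 : 0 < √(1 - ε) := sqrt_pos.2 (by linarith)
  have h2 : 0 < √(1 + ε) := sqrt_pos.2 (by linarith)
  have hint : Integrable (fun z => exp (ε / 2 * (‖U.starProjection z‖ ^ 2 -
      ‖Uᗮ.starProjection z‖ ^ 2))) (stdGaussian E) := by
    -- A non-integrable function has integral 0 by convention, whereas `hI` gives a positive value.
    by_contra hn
    rw [integral_undef hn] at hI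
    have : 0 < (√(1 - ε))⁻¹ ^ Module.finrank ℝ U * (√(1 + ε))⁻¹ ^ Module.finrank ℝ Uᗮ := by
      positivity
    exact this.ne hI
  have hmarkov := mul_meas_ge_le_integral_of_nonneg (ae_of_all _ fun z => (exp_pos _).le) hint 1
  rw [one_mul, hI] at hmarkov
  have hsub : {z : E | 2 * ‖Uᗮ.starProjection z‖ ^ 2 ≤ ‖z‖ ^ 2} ⊆
      {z | 1 ≤ exp (ε / 2 * (‖U.starProjection z‖ ^ 2 - ‖Uᗮ.starProjection z‖ ^ 2))} := by
    intro z hz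
    have hz' : 2 * ‖Uᗮ.starProjection z‖ ^ 2 ≤ ‖z‖ ^ 2 := hz
    rw [U.norm_sq_eq_add_norm_sq_starProjection z] at hz'
    exact one_le_exp (mul_nonneg (by linarith) (by linarith))
  refine (measureReal_mono hsub).trans (hmarkov.trans ?_)
  have hsum : (Module.finrank ℝ U : ℝ) + Module.finrank ℝ Uᗮ = Module.finrank ℝ E := by
    exact_mod_cast U.finrank_add_finrank_orthogonal
  set d : ℝ := (Module.finrank ℝ U : ℝ)
  set d' : ℝ := (Module.finrank ℝ Uᗮ : ℝ)
  set n : ℝ := (Module.finrank ℝ E : ℝ)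
  have hn : 0 ≤ n := Nat.cast_nonneg _
  have hrw : (√(1 - ε))⁻¹ ^ Module.finrank ℝ U * (√(1 + ε))⁻¹ ^ Module.finrank ℝ Uᗮ =
      exp (-(1 / 2) * (d * log (1 - ε) + d' * log (1 + ε))) := by
    rw [← exp_log (show 0 < (√(1 - ε))⁻¹ ^ Module.finrank ℝ U *
      (√(1 + ε))⁻¹ ^ Module.finrank ℝ Uᗮ by positivity), log_mul (by positivity) (by positivity),
      log_pow, log_pow, log_inv, log_inv, log_sqrt (by linarith), log_sqrt (by linarith)]
    simp only [d, d']
    ring_nf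
  rw [hrw]
  refine exp_le_exp.2 ?_
  have l1 : -(ε / (1 - ε)) ≤ log (1 - ε) := by
    have := one_sub_inv_le_log_of_pos (show 0 < 1 - ε by linarith)
    refine le_trans (le_of_eq ?_) this
    have : 1 - ε ≠ 0 := by linarith
    field_simp
    ring
  have l2 : ε / (1 + ε) ≤ log (1 + ε) := by
    have := one_sub_inv_le_log_of_pos (show 0 < 1 + ε by linarith)
    refine le_trans (le_of_eq ?_) this
    field_simp
    ring
  have l3 : log (1 - ε) ≤ log (1 + ε) := log_le_log (by linarith) (by linarith)
  -- By `l3` the worst dimension is the largest allowed, `(1/2 - ε) * n`; there `l1` and `l2` sum to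
  -- `ε ^ 2 / (1 - ε ^ 2)`.
  have hmain : ε ^ 2 ≤ (1 / 2 - ε) * log (1 - ε) + (1 / 2 + ε) * log (1 + ε) := by
    have a1 := mul_le_mul_of_nonneg_left l1 (show 0 ≤ 1 / 2 - ε by linarith)
    have a2 := mul_le_mul_of_nonneg_left l2 (show 0 ≤ 1 / 2 + ε by linarith)
    refine le_trans ?_ (add_le_add a1 a2)
    have e1 : (1 / 2 - ε) * -(ε / (1 - ε)) + (1 / 2 + ε) * (ε / (1 + ε)) =
        ε ^ 2 / (1 - ε ^ 2) := by
      have : 1 - ε ≠ 0 := by linarith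
      have : 1 + ε ≠ 0 := by linarith
      have : 1 - ε ^ 2 ≠ 0 := by nlinarith
      field_simp
      ring
    rw [e1, le_div_iff₀ (by nlinarith)]
    nlinarith [sq_nonneg ε]
  have hd' : d' = n - d := by linarith
  have h3 := mul_nonneg (sub_nonneg.2 hU) (sub_nonneg.2 l3)
  have h4 := mul_le_mul_of_nonneg_left hmain hn
  rw [hd']
  nlinarith

end Chernoff

/-! ### From a fixed subspace to a random one, by rotation invariance. -/

section RandomSubspace

variable {E : Type*} [NormedAddCommGroup E] [InnerProductSpace ℝ E] [FiniteDimensional ℝ E]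
  {r : ℕ}

/-- The projection is not continuous in `c` where the rank drops, but this form shows its strict
sublevel sets to be unions of open sets, hence measurable. -/
lemma norm_starProjection_orthogonal_span_lt_iff (c : Fin r → E) (v : E) (s : ℝ) :
    ‖(Submodule.span ℝ (Set.range c))ᗮ.starProjection v‖ < s ↔
      ∃ x : Fin r → ℝ, ‖v - ∑ j, x j • c j‖ < s := by
  rw [Submodule.starProjection_orthogonal_val]
  constructor
  · intro h
    obtain ⟨x, hx⟩ := (Submodule.mem_span_range_iff_exists_fun ℝ).1
      ((Submodule.span ℝ (Set.range c)).starProjection_apply_mem v)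
    exact ⟨x, by rwa [hx]⟩
  · rintro ⟨x, hx⟩
    refine lt_of_le_of_lt ?_ hx
    rw [Submodule.starProjection_minimal]
    have hbdd : BddBelow (Set.range fun y : Submodule.span ℝ (Set.range c) => ‖v - y‖) :=
      ⟨0, Set.forall_mem_range.2 fun _ => norm_nonneg _⟩
    exact ciInf_le hbdd ⟨_, (Submodule.mem_span_range_iff_exists_fun ℝ).2 ⟨x, rfl⟩⟩

/-- Pairs of a tuple `c` and a vector `v` such that `v` is at least as far from the orthogonal
complement of the span of `c` as from the span itself. -/
def nearSpan (E : Type*) [NormedAddCommGroup E] [InnerProductSpace ℝ E] [FiniteDimensional ℝ E]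
    (r : ℕ) : Set ((Fin r → E) × E) :=
  {p | 2 * ‖(Submodule.span ℝ (Set.range p.1))ᗮ.starProjection p.2‖ ^ 2 ≤ ‖p.2‖ ^ 2}

lemma mk_smul_mem_nearSpan_iff {c : Fin r → E} {v : E} {t : ℝ} (ht : t ≠ 0) :
    (c, t • v) ∈ nearSpan E r ↔ (c, v) ∈ nearSpan E r := by
  have h : 0 < ‖t‖ ^ 2 := by positivity
  simp only [nearSpan, Set.mem_ofPred_eq, map_smul, norm_smul, mul_pow]
  rw [mul_left_comm, mul_le_mul_iff_right₀ h]

lemma isometry_mem_nearSpan_iff (L : E ≃ₗᵢ[ℝ] E) {c : Fin r → E} {v : E} :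
    (fun j => L (c j), L v) ∈ nearSpan E r ↔ (c, v) ∈ nearSpan E r := by
  have h : Submodule.span ℝ (Set.range fun j => L (c j)) =
      (Submodule.span ℝ (Set.range c)).map (L.toLinearEquiv : E →ₗ[ℝ] E) := by
    rw [Submodule.map_span, ← Set.range_comp]
    rfl
  simp only [nearSpan, Set.mem_ofPred_eq, Submodule.starProjection_orthogonal_val]
  rw [h, Submodule.starProjection_map_apply, L.symm_apply_apply, ← map_sub, L.norm_map, L.norm_map]

variable [MeasurableSpace E] [BorelSpace E] [SecondCountableTopology E]

lemma measurable_norm_starProjection_orthogonal_span :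
    Measurable fun p : (Fin r → E) × E =>
      ‖(Submodule.span ℝ (Set.range p.1))ᗮ.starProjection p.2‖ := by
  refine measurable_of_Iio fun s => ?_
  have h : (fun p : (Fin r → E) × E =>
      ‖(Submodule.span ℝ (Set.range p.1))ᗮ.starProjection p.2‖) ⁻¹' Set.Iio s =
      ⋃ x : Fin r → ℝ, {p | ‖p.2 - ∑ j, x j • p.1 j‖ < s} := by
    ext p
    simp only [Set.mem_preimage, Set.mem_Iio, norm_starProjection_orthogonal_span_lt_iff,
      Set.mem_iUnion, Set.mem_ofPred_eq]
  rw [h]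
  exact (isOpen_iUnion fun x => isOpen_lt (by fun_prop) continuous_const).measurableSet

lemma measurableSet_nearSpan : MeasurableSet (nearSpan E r) :=
  measurableSet_le ((measurable_norm_starProjection_orthogonal_span.pow_const 2).const_mul 2)
    (by fun_prop)

lemma pi_stdGaussian_map_isometry (L : E ≃ₗᵢ[ℝ] E) :
    (Measure.pi fun _ : Fin r => stdGaussian E).map (fun c j => L (c j)) =
      Measure.pi fun _ : Fin r => stdGaussian E := by
  have hL : (stdGaussian E).map L = stdGaussian E := stdGaussian_map L
  have : SigmaFinite ((stdGaussian E).map L) := by rw [hL]; infer_instance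
  have h := Measure.pi_map_pi (μ := fun _ : Fin r => stdGaussian E)
    (f := fun _ : Fin r => (L : E → E)) (fun _ => L.continuous.measurable.aemeasurable)
  rwa [hL] at h

/-- For a Gaussian tuple `c`, the probability of `(c, v) ∈ nearSpan E r` only depends on the norm
of `v`. -/
lemma pi_stdGaussian_nearSpan_congr {v w : E} (h : ‖v‖ = ‖w‖) :
    Measure.pi (fun _ : Fin r => stdGaussian E) {c | (c, v) ∈ nearSpan E r} =
      Measure.pi (fun _ : Fin r => stdGaussian E) {c | (c, w) ∈ nearSpan E r} := by
  have hmeas : MeasurableSet {c : Fin r → E | (c, w) ∈ nearSpan E r} :=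
    measurableSet_nearSpan.preimage (by fun_prop)
  -- As the norms agree, reflecting in the hyperplane orthogonal to `v - w` carries `v` to `w`.
  let L : E ≃ₗᵢ[ℝ] E := (ℝ ∙ (v - w))ᗮ.reflection
  have hL : L v = w := Submodule.reflection_sub h
  conv_rhs => rw [← pi_stdGaussian_map_isometry L]
  rw [Measure.map_apply (by fun_prop) hmeas]
  congr 1
  ext c
  simp only [Set.mem_ofPred_eq, Set.mem_preimage, ← hL, isometry_mem_nearSpan_iff]

/-- The span of a short tuple of independent Gaussian vectors is unlikely to be near to a given
unit vector. -/
lemma pi_stdGaussian_nearSpan_le {ε : ℝ} (hε₀ : 0 < ε) (hε₁ : ε < 1 / 2)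
    (hr : (r : ℝ) ≤ (1 / 2 - ε) * Module.finrank ℝ E) {e : E} (he : ‖e‖ = 1) :
    Measure.pi (fun _ : Fin r => stdGaussian E) {c | (c, e) ∈ nearSpan E r} ≤
      ENNReal.ofReal (Real.exp (-(ε ^ 2 / 2) * Module.finrank ℝ E)) := by
  set ν := Measure.pi (fun _ : Fin r => stdGaussian E)
  -- Equality holds for `v ≠ 0` by scaling and rotation; at `v = 0` the right-hand event is
  -- everything. Averaging over a Gaussian `v` thus only increases the bound.
  have hle : ∀ v : E, ν {c | (c, e) ∈ nearSpan E r} ≤ ν {c | (c, v) ∈ nearSpan E r} := by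
    intro v
    by_cases hv : v = 0
    · refine measure_mono fun c _ => ?_
      simp [nearSpan, hv]
    · have hv' : ‖v‖ ≠ 0 := norm_ne_zero_iff.2 hv
      rw [pi_stdGaussian_nearSpan_congr (show ‖e‖ = ‖(‖v‖)⁻¹ • v‖ by
        rw [norm_smul, he, norm_inv, norm_norm, inv_mul_cancel₀ hv'])]
      simp_rw [mk_smul_mem_nearSpan_iff (inv_ne_zero hv')]
      exact le_rfl
  calc ν {c | (c, e) ∈ nearSpan E r}
      = ∫⁻ _ : E, ν {c | (c, e) ∈ nearSpan E r} ∂(stdGaussian E) := by simp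
    _ ≤ ∫⁻ v, ν {c | (c, v) ∈ nearSpan E r} ∂(stdGaussian E) := lintegral_mono hle
    _ = (ν.prod (stdGaussian E)) (nearSpan E r) :=
        (Measure.prod_apply_symm measurableSet_nearSpan).symm
    _ = ∫⁻ c, stdGaussian E {v | (c, v) ∈ nearSpan E r} ∂ν :=
        Measure.prod_apply measurableSet_nearSpan
    _ ≤ ∫⁻ _, ENNReal.ofReal (Real.exp (-(ε ^ 2 / 2) * Module.finrank ℝ E)) ∂ν := by
        refine lintegral_mono fun c => ?_
        rw [← ofReal_measureReal]
        have hc : (Module.finrank ℝ (Submodule.span ℝ (Set.range c)) : ℝ) ≤ r := by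
          exact_mod_cast (finrank_range_le_card c).trans_eq (Fintype.card_fin r)
        have h := stdGaussian_norm_starProjection_orthogonal_le (Submodule.span ℝ (Set.range c))
          hε₀ hε₁ (hc.trans hr)
        exact ENNReal.ofReal_le_ofReal h
    _ = _ := by simp

end RandomSubspace

/-! ### Gaussian matrices and the union bound. -/

/-- The columns of a standard Gaussian matrix are independent standard Gaussian vectors. -/
lemma IsStdGaussianMatrix.hasLaw_columns {Ω : Type*} [MeasurableSpace Ω] {P : Measure Ω} {n r : ℕ}
    {G : Ω → Matrix (Fin n) (Fin r) ℝ} (hG : IsStdGaussianMatrix P G) :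
    HasLaw (fun ω j => WithLp.toLp 2 fun i => G ω i j)
      (Measure.pi fun _ : Fin r => stdGaussian (EuclideanSpace ℝ (Fin n))) P := by
  have hae : ∀ i j, AEMeasurable (fun ω => G ω i j) P := fun i j => (hG.1 i j).aemeasurable
  have haem : AEMeasurable (fun ω (p : Fin r × Fin n) => G ω p.2 p.1) P :=
    aemeasurable_pi_iff.2 fun p => hae p.2 p.1
  have hind : iIndepFun (fun (p : Fin r × Fin n) (ω : Ω) => G ω p.2 p.1) P :=
    hG.2.precomp (g := Prod.swap) Prod.swap_injective
  have hlaw : P.map (fun ω (p : Fin r × Fin n) => G ω p.2 p.1) =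
      Measure.infinitePi fun _ : Fin r × Fin n => gaussianReal 0 1 := by
    rw [hind.map_fun_eq_infinitePi_map₀ haem]
    simp_rw [(hG.1 _ _).map_eq]
  have hcurry := Measure.infinitePi_map_curry (fun (_ : Fin r) (_ : Fin n) => gaussianReal 0 1)
  simp_rw [Measure.infinitePi_eq_pi] at hcurry
  refine ⟨aemeasurable_pi_iff.2 fun j =>
    (WithLp.measurable_toLp 2 _).comp_aemeasurable (aemeasurable_pi_iff.2 fun i => hae i j), ?_⟩
  have hcomp : (fun ω j => WithLp.toLp 2 fun i => G ω i j) =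
      (fun (c : Fin r → Fin n → ℝ) j => WithLp.toLp 2 (c j)) ∘
        (MeasurableEquiv.curry (Fin r) (Fin n) ℝ) ∘ fun ω (p : Fin r × Fin n) => G ω p.2 p.1 := rfl
  have hm : Measurable fun (c : Fin r → Fin n → ℝ) j => WithLp.toLp 2 (c j) := by fun_prop
  rw [hcomp, ← AEMeasurable.map_map_of_aemeasurable hm.aemeasurable
    ((MeasurableEquiv.measurable _).comp_aemeasurable haem),
    ← AEMeasurable.map_map_of_aemeasurable (MeasurableEquiv.measurable _).aemeasurable haem,
    hlaw, Measure.infinitePi_eq_pi, hcurry]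
  have hpi := Measure.pi_map_pi (μ := fun _ : Fin r => Measure.pi fun _ : Fin n => gaussianReal 0 1)
    (f := fun _ : Fin r => (WithLp.toLp 2 : (Fin n → ℝ) → EuclideanSpace ℝ (Fin n)))
    (hμ := fun _ => by rw [map_pi_eq_stdGaussian]; infer_instance)
    (fun _ => (WithLp.measurable_toLp 2 _).aemeasurable)
  simp_rw [map_pi_eq_stdGaussian] at hpi
  exact hpi

lemma toLp_mem_span_of_mem_columnSpace {n r : ℕ} {A : Matrix (Fin n) (Fin r) ℝ} {x : Fin n → ℝ}
    (hx : x ∈ columnSpace A) :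
    WithLp.toLp 2 x ∈ Submodule.span ℝ
      (Set.range fun j => (WithLp.toLp 2 fun i => A i j : EuclideanSpace ℝ (Fin n))) := by
  obtain ⟨y, rfl⟩ := hx
  refine (Submodule.mem_span_range_iff_exists_fun ℝ).2 ⟨y, ?_⟩
  ext i
  simp [Matrix.mulVec, dotProduct, mul_comm]

theorem proposition4p6 (ε : ℝ) (hε₀ : 0 < ε) (hε₁ : ε < 1 / 2) :
    ∃ cbar ctilde : ℝ, 0 < cbar ∧ 0 < ctilde ∧
      ∀ n r : ℕ, 6 / (ε ^ 2 - 2 * ε ^ 3) < (n : ℝ) → (r : ℝ) ≤ (1 / 2 - ε) * n →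
        ∀ (Ω : Type*) [MeasurableSpace Ω] (P : Measure Ω) [IsProbabilityMeasure P]
          (G : Ω → Matrix (Fin n) (Fin r) ℝ), IsStdGaussianMatrix P G →
          1 - cbar * Real.sqrt n * Real.exp (-ctilde * n) ≤
            P.real {ω | IsRealizable (columnSpace (G ω))} := by
  -- The union bound gives `n * exp (-(ε ^ 2 / 2) * n)`. Half of the exponent is spent absorbing a
  -- factor `√n ≤ n ≤ 4 / ε ^ 2 * exp (ε ^ 2 / 4 * n)`.
  refine ⟨4 / ε ^ 2, ε ^ 2 / 4, by positivity, by positivity, ?_⟩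
  intro n r _ hr Ω _ P _ G hG
  have hlaw := hG.hasLaw_columns
  let c : Ω → Fin r → EuclideanSpace ℝ (Fin n) := fun ω j => WithLp.toLp 2 fun i => G ω i j
  let B : Fin n → Set Ω := fun i => {ω | (c ω, EuclideanSpace.single i 1) ∈ nearSpan (EuclideanSpace ℝ (Fin n)) r}
  have hB : ∀ i, P.real (B i) ≤ Real.exp (-(ε ^ 2 / 2) * n) := by
    intro i
    have h := pi_stdGaussian_nearSpan_le (E := EuclideanSpace ℝ (Fin n)) (r := r) hε₀ hε₁ (by simpa using hr)
      (e := EuclideanSpace.single i 1) (by simp)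
    rw [← hlaw.measure_eq (measurableSet_nearSpan.preimage (by fun_prop))] at h
    rw [finrank_euclideanSpace_fin] at h
    exact ENNReal.toReal_le_of_le_ofReal (Real.exp_pos _).le h
  have hcover : Set.univ ⊆ {ω | IsRealizable (columnSpace (G ω))} ∪ ⋃ i, B i := by
    intro ω _
    by_cases h : ω ∈ ⋃ i, B i
    · exact Or.inr h
    · refine Or.inl (isRealizable_of_lt_norm_starProjection _ _
        (fun x hx => toLp_mem_span_of_mem_columnSpace hx) fun i => ?_)
      have hi : ω ∉ B i := fun hi => h (Set.mem_iUnion.2 ⟨i, hi⟩)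
      have hi' : ¬ 2 * ‖(Submodule.span ℝ (Set.range (c ω)))ᗮ.starProjection
          (EuclideanSpace.single i (1 : ℝ))‖ ^ 2 ≤
          ‖(EuclideanSpace.single i 1 : EuclideanSpace ℝ (Fin n))‖ ^ 2 := hi
      simpa only [not_le, PiLp.norm_single, norm_one, one_pow] using hi'
  -- Subadditivity over a cover, unlike passing to complements, needs no measurability of the
  -- realizable event.
  have h1 : 1 ≤ P.real {ω | IsRealizable (columnSpace (G ω))} + ∑ i, P.real (B i) := by
    rw [← probReal_univ (μ := P)]
    refine (measureReal_mono hcover).trans ((measureReal_union_le _ _).trans ?_)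
    gcongr
    exact measureReal_iUnion_fintype_le B
  have h2 : ∑ i, P.real (B i) ≤ n * Real.exp (-(ε ^ 2 / 2) * n) := by
    refine (Finset.sum_le_sum fun i _ => hB i).trans_eq ?_
    simp
  have h3 : (n : ℝ) * Real.exp (-(ε ^ 2 / 2) * n) ≤
      4 / ε ^ 2 * √n * Real.exp (-(ε ^ 2 / 4) * n) := by
    have hsq : √(n : ℝ) ≤ n := by
      rcases Nat.eq_zero_or_pos n with rfl | hn
      · simp
      · exact Real.sqrt_le_iff.2 ⟨Nat.cast_nonneg n, by exact_mod_cast Nat.le_self_pow two_ne_zero n⟩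
    have hexp : √(n : ℝ) ≤ 4 / ε ^ 2 * Real.exp (ε ^ 2 / 4 * n) := by
      refine hsq.trans ?_
      have := Real.add_one_le_exp (ε ^ 2 / 4 * n)
      rw [div_mul_eq_mul_div, le_div_iff₀ (by positivity)]
      linarith
    calc (n : ℝ) * Real.exp (-(ε ^ 2 / 2) * n)
        = √n * Real.exp (-(ε ^ 2 / 2) * n) * √n := by
          rw [mul_right_comm, Real.mul_self_sqrt (Nat.cast_nonneg n)]
      _ ≤ √n * Real.exp (-(ε ^ 2 / 2) * n) * (4 / ε ^ 2 * Real.exp (ε ^ 2 / 4 * n)) := by gcongr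
      _ = 4 / ε ^ 2 * √n * (Real.exp (-(ε ^ 2 / 2) * n) * Real.exp (ε ^ 2 / 4 * n)) := by ring
      _ = _ := by
          rw [← Real.exp_add]
          ring_nf
  linarith
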